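/- Let $0<\alpha\le 2$ and let $S_\alpha(\sigma,0,0)$ denote the law on $\mathbb R$ with characteristic function $\theta\mapsto e^{-\sigma^\alpha|\theta|^\alpha}$ ($\sigma\ge 0$). For a random variable $X$ with this law write $\|X\|_\alpha=\sigma$. Let $M$ be a symmetric $\alpha$-stable random measure on $\mathbb R$ with Lebesgue control measure $\mathcal L$ (independently scattered, almost surely $\sigma$-additive, $M(A)\sim S_\alpha(\mathcal L(A)^{1/\alpha},0,0)$ for measurable $A$ with $\mathcal L(A)<\infty$). Let $g\in L^\alpha(\mathbb R)$ be real-valued and let $Y(t)=\int g(t-x)\,M(dx)$, $t\in\mathbb R$. Suppose there are real numbers $c_0^+,c_0^-,\gamma,a,c,\eta$ with $c>0$, $\eta>0$ and $0<\gamma+1/\alpha<a\le 1$ such that $g(r)/r^\gamma\to c_0^+$ and $g(-r)/r^\gamma\to c_0^-$ as $r\searrow 0$, and $$|g(u+h)-g(u)|\le c\,|h|^a|u|^{\gamma-a}\qquad(u\in\mathbb R\setminus\{0\},\ |h|<\eta).$$ For integers $\omega\ge 1$, $\Omega\ge 1$ and $k\in\mathbb Z$ put $$Y_{\omega,\Omega}(k)=\sum_{j=-\omega\Omega+1}^{0}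 g\Big(\frac{j-1}{\omega}\Big)Z_{\alpha,\omega}(\omega k-j)+\sum_{j=1}^{\omega\Omega} g\Big(\frac{j}{\omega}\Big)Z_{\alpha,\omega}(\omega k-j),\qquad Z_{\alpha,\omega}(j)=M\Big(\frac{j+1}{\omega}\Big)-M\Big(\frac{j}{\omega}\Big),$$ where $M(t)=\int_0^t M(dx)$. Then $Y(k)-Y_{\omega,\Omega}(k)$ is symmetric $\alpha$-stable, and for every $k\in\mathbb Z$ $$\|Y(k)-Y_{\omega,\Omega}(k)\|_\alpha\to 0\quad\text{as }\omega\to\infty\text{ and }\Omega\to\infty .$$ If in addition there are $C>0$ and $\beta>1/\alpha$ such that $|g(x)|\le C|x|^{-\beta}$ for all sufficiently large $|x|$, then there is a constant $K>0$, independent of $k,\omega,\Omega$, such that for all $k\in\mathbb Z$ and all integers $\omega>1/\eta$, $\Omega\ge 1$, $$\|Y(k)-Y_{\omega,\Omega}(k)\|_\alpha^\alpha\le K\left(\omega^{-1-\alpha\gamma}+\Omega^{1-\alpha\beta}\right).$$ -/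

import Mathlib

open MeasureTheory ProbabilityTheory Filter Topology

/-- The real random variable `X` on `(S, P)` has the symmetric `α`-stable law `S_α(σ, 0, 0)` with
scale parameter `σ ≥ 0`: its characteristic function is `θ ↦ exp (-σ ^ α |θ| ^ α)`. -/
def HasSymmetricStableLaw {S : Type*} [MeasurableSpace S] (P : Measure S) (α σ : ℝ)
    (X : S → ℝ) : Prop :=
  0 ≤ σ ∧ AEMeasurable X P ∧
    ∀ θ : ℝ, charFun (P.map X) θ = Complex.exp (-((σ ^ α * |θ| ^ α : ℝ) : ℂ))

/-- The `α`-norm `‖X‖_α` of a symmetric `α`-stable random variable `X`, that is, its scale factor: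
the unique `σ ≥ 0` such that `X` has law `S_α(σ, 0, 0)` (the set below has at most one element;
the value is only meaningful if there is such a `σ`). -/
noncomputable def stableNorm {S : Type*} [MeasurableSpace S] (P : Measure S) (α : ℝ)
    (X : S → ℝ) : ℝ :=
  sInf {σ : ℝ | HasSymmetricStableLaw P α σ X}

/-- `M` is a symmetric `α`-stable random measure on `E` with control measure `m`: an independently
scattered, almost surely `σ`-additive random set function on the measurable sets of finite
`m`-measure such that `M A` has law `S_α(m(A) ^ (1 / α), 0, 0)`.  The values of `M` on all other
sets are irrelevant. -/
structure IsSymmetricStableRandomMeasure {S E : Type*} [MeasurableSpace S] [MeasurableSpace E]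
    (P : Measure S) (α : ℝ) (m : Measure E) (M : Set E → S → ℝ) : Prop where
  measurable : ∀ A : Set E, MeasurableSet A → m A < ⊤ → Measurable (M A)
  law : ∀ A : Set E, MeasurableSet A → m A < ⊤ →
    HasSymmetricStableLaw P α ((m A).toReal ^ (1 / α)) (M A)
  indep : ∀ (n : ℕ) (A : Fin n → Set E), (∀ i, MeasurableSet (A i)) → (∀ i, m (A i) < ⊤) →
    Pairwise (fun i j => Disjoint (A i) (A j)) → iIndepFun (fun i => M (A i)) P
  sigma_additive : ∀ A : ℕ → Set E, (∀ i, MeasurableSet (A i)) → m (⋃ i, A i) < ⊤ →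
    Pairwise (fun i j => Disjoint (A i) (A j)) →
    ∀ᵐ s ∂P, Tendsto (fun n : ℕ => ∑ i ∈ Finset.range n, M (A i) s) atTop (𝓝 (M (⋃ i, A i) s))

/-- The integral `∑ y, y M(f = y)` of a simple function `f` with respect to `M`. -/
noncomputable def simpleStableIntegral {S E : Type*} [MeasurableSpace E]
    (M : Set E → S → ℝ) (f : SimpleFunc E ℝ) : S → ℝ :=
  fun s => ∑ y ∈ f.range, y * M (f ⁻¹' {y}) s

/-- `X` is (a version of) the stochastic integral `∫ f dM`: the limit in probability of the
integrals of simple functions, with support of finite measure, converging to `f` in `L ^ α(m)`. -/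
def IsStableIntegral {S E : Type*} [MeasurableSpace S] [MeasurableSpace E]
    (P : Measure S) (α : ℝ) (m : Measure E) (M : Set E → S → ℝ) (f : E → ℝ) (X : S → ℝ) : Prop :=
  Measurable X ∧ ∃ φ : ℕ → SimpleFunc E ℝ,
    (∀ n, (φ n).FinMeasSupp m) ∧
    Tendsto (fun n => eLpNorm (fun x => φ n x - f x) (ENNReal.ofReal α) m) atTop (𝓝 0) ∧
    TendstoInMeasure P (fun n => simpleStableIntegral M (φ n)) atTop X

open Classical in
/-- The stochastic integral `∫ f dM` (determined up to almost sure equality). -/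
noncomputable def stableIntegral {S E : Type*} [MeasurableSpace S] [MeasurableSpace E]
    (P : Measure S) (α : ℝ) (m : Measure E) (M : Set E → S → ℝ) (f : E → ℝ) : S → ℝ :=
  if h : ∃ X : S → ℝ, IsStableIntegral P α m M f X then h.choose else 0

/-- `Y` is the moving average process with kernel `g`: for each `t`, almost surely,
`Y(t) = ∫ g(t - x) M(dx)`. -/
def IsMovingAverage {S : Type*} [MeasurableSpace S] (P : Measure S) (α : ℝ)
    (M : Set ℝ → S → ℝ) (g : ℝ → ℝ) (Y : ℝ → S → ℝ) : Prop :=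
  ∀ t : ℝ, Y t =ᵐ[P] stableIntegral P α volume M (fun x => g (t - x))

/-- The process `M(t) = ∫_0^t M(dx)`, with `∫_0^t = -∫_t^0` for `t < 0`. -/
noncomputable def stableMotion {S : Type*} (M : Set ℝ → S → ℝ) (t : ℝ) : S → ℝ :=
  fun s => if 0 ≤ t then M (Set.Ioc 0 t) s else -M (Set.Ioc t 0) s

/-- `Z_{α,ω}(j) = M((j + 1) / ω) - M(j / ω)`. -/
noncomputable def stableIncrement {S : Type*} (M : Set ℝ → S → ℝ) (ω : ℕ) (j : ℤ) : S → ℝ :=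
  fun s => stableMotion M (((j : ℝ) + 1) / (ω : ℝ)) s - stableMotion M ((j : ℝ) / (ω : ℝ)) s

/-- The approximation `Y_{ω,Ω}(k)` of `Y(k)` with discretization step `1 / ω` and cut-off `Ω`. -/
noncomputable def movingAverageApprox {S : Type*} (M : Set ℝ → S → ℝ) (g : ℝ → ℝ)
    (ω Ω : ℕ) (k : ℤ) : S → ℝ :=
  fun s =>
    ∑ j ∈ Finset.Icc (-((ω : ℤ) * (Ω : ℤ)) + 1) 0,
        g (((j : ℝ) - 1) / (ω : ℝ)) * stableIncrement M ω ((ω : ℤ) * k - j) s +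
      ∑ j ∈ Finset.Icc (1 : ℤ) ((ω : ℤ) * (Ω : ℤ)),
        g ((j : ℝ) / (ω : ℝ)) * stableIncrement M ω ((ω : ℤ) * k - j) s

/-- The approximation error `Y(k) - Y_{ω,Ω}(k)`. -/
noncomputable def approxError {S : Type*} (M : Set ℝ → S → ℝ) (g : ℝ → ℝ) (Y : ℝ → S → ℝ)
    (ω Ω : ℕ) (k : ℤ) : S → ℝ :=
  fun s => Y (k : ℝ) s - movingAverageApprox M g ω Ω k s

/-! ### Symmetric stable laws and their scale. -/

section StableLaw

variable {S : Type*} [MeasurableSpace S] {P : Measure S} {α : ℝ} {X Y : S → ℝ}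

/-! The approximation is itself a stochastic integral: it integrates a step function, equal on each
reflected grid cell to `g` at the endpoint farther from the origin and zero outside the cells. By
linearity the error is the integral of `x ↦ g (k - x)` minus this step function. The integral of `f`
has scale `(∫ |f| ^ α) ^ (1 / α)`, so the error is stable and the `α`-th power of its norm is a
deterministic `L ^ α` distance (`IsMovingAverage.hasSymmetricStableLaw_approxError`).

That distance splits in two (`powLIntegral_sub_stepApprox_le`). On a cell whose far endpoint is at
distance `d / ω` from the origin, the increment condition bounds the difference by `c * ω ^ (-a) *
(d / ω) ^ (γ - a)`. Raised to the power `α` and multiplied by the cell length, this is a multiple of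
`ω ^ (-1 - α * γ) * d ^ (α * (γ - a))`. The sum over `d` converges since `γ + 1 / α < a`, and the
power of `ω` tends to zero since `0 < γ + 1 / α`. Off the cells there remains the tail of `∫ |g| ^
α` over `|u| ≥ Ω`, which vanishes by integrability and is of order `Ω ^ (1 - α * β)` under
polynomial decay.

The isometry is proved for simple functions from independence
(`hasSymmetricStableLaw_simpleStableIntegral`) and passes to the limit through characteristic
functions. -/

theorem hasSymmetricStableLaw_rpow_iff (hα : 0 < α) {v : ℝ} (hv : 0 ≤ v) :
    HasSymmetricStableLaw P α (v ^ (1 / α)) X ↔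
      AEMeasurable X P ∧
        ∀ θ : ℝ, charFun (P.map X) θ = Complex.exp (-((v * |θ| ^ α : ℝ) : ℂ)) := by
  have h : (v ^ (1 / α)) ^ α = v := by
    rw [← Real.rpow_mul hv, one_div_mul_cancel hα.ne', Real.rpow_one]
  simp only [HasSymmetricStableLaw, h]
  exact ⟨fun h => h.2, fun h => ⟨Real.rpow_nonneg hv _, h⟩⟩

theorem HasSymmetricStableLaw.congr {σ : ℝ} (h : HasSymmetricStableLaw P α σ X)
    (hXY : X =ᵐ[P] Y) : HasSymmetricStableLaw P α σ Y :=
  ⟨h.1, h.2.1.congr hXY, by simpa only [Measure.map_congr hXY] using h.2.2⟩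

theorem HasSymmetricStableLaw.unique (hα : 0 < α) {σ τ : ℝ}
    (h : HasSymmetricStableLaw P α σ X) (h' : HasSymmetricStableLaw P α τ X) : σ = τ := by
  have h1 := (h.2.2 1).symm.trans (h'.2.2 1)
  rw [← Complex.ofReal_neg, ← Complex.ofReal_neg, ← Complex.ofReal_exp, ← Complex.ofReal_exp,
    Complex.ofReal_inj, Real.exp_eq_exp] at h1
  simp only [abs_one, Real.one_rpow, mul_one, neg_inj] at h1
  exact (Real.rpow_left_inj h.1 h'.1 hα.ne').1 h1

theorem HasSymmetricStableLaw.stableNorm_eq (hα : 0 < α) {σ : ℝ}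
    (h : HasSymmetricStableLaw P α σ X) : stableNorm P α X = σ := by
  have : {σ : ℝ | HasSymmetricStableLaw P α σ X} = {σ} :=
    Set.eq_singleton_iff_unique_mem.2 ⟨h, fun τ hτ => HasSymmetricStableLaw.unique hα hτ h⟩
  rw [stableNorm, this, csInf_singleton]

/-- The characteristic function is constantly 1, so the law is the Dirac mass at 0. Applied to `M A`
for null sets, in particular the empty set. -/
theorem HasSymmetricStableLaw.ae_eq_zero [IsProbabilityMeasure P] (hα : 0 < α)
    (h : HasSymmetricStableLaw P α 0 X) : X =ᵐ[P] 0 := by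
  have := Measure.isProbabilityMeasure_map h.2.1
  have h1 : P.map X = Measure.dirac 0 := by
    refine Measure.ext_of_charFun ?_
    ext θ
    rw [h.2.2 θ, charFun_dirac]
    simp [Real.zero_rpow hα.ne']
  have h2 : ∀ᵐ x ∂(P.map X), x = 0 := by
    rw [h1]
    simp [ae_dirac_eq]
  exact ae_of_ae_map h.2.1 h2

end StableLaw

/-! ### Linearity and law of the integral of simple functions. -/

namespace IsSymmetricStableRandomMeasure

variable {S E : Type*} [MeasurableSpace S] [MeasurableSpace E] {P : Measure S}
  [IsProbabilityMeasure P] {α : ℝ} {m : Measure E} {M : Set E → S → ℝ}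

theorem ae_eq_zero (hM : IsSymmetricStableRandomMeasure P α m M) (hα : 0 < α) {A : Set E}
    (hA : MeasurableSet A) (h0 : m A = 0) : M A =ᵐ[P] 0 := by
  have h := hM.law A hA (by simp [h0])
  rw [h0, ENNReal.toReal_zero, Real.zero_rpow (one_div_pos.2 hα).ne'] at h
  exact h.ae_eq_zero hα

/-- Pad the pair with empty sets and use σ-additivity: the partial sums are eventually constant
because `M ∅` vanishes almost surely. -/
theorem union (hM : IsSymmetricStableRandomMeasure P α m M) (hα : 0 < α) {A B : Set E}
    (hA : MeasurableSet A) (hB : MeasurableSet B) (hAB : Disjoint A B) (hmA : m A < ⊤)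
    (hmB : m B < ⊤) : M (A ∪ B) =ᵐ[P] M A + M B := by
  let C : ℕ → Set E := fun n => if n = 0 then A else if n = 1 then B else ∅
  have hC : ⋃ n, C n = A ∪ B := by
    ext x
    simp only [Set.mem_iUnion, Set.mem_union]
    constructor
    · rintro ⟨n, hn⟩
      by_cases h0 : n = 0
      · exact Or.inl (by simpa [C, h0] using hn)
      · by_cases h1 : n = 1
        · exact Or.inr (by simpa [C, h1] using hn)
        · simp [C, h0, h1] at hn
    · rintro (h | h)
      · exact ⟨0, by simpa [C] using h⟩
      · exact ⟨1, by simpa [C] using h⟩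
  have hmeas : ∀ n, MeasurableSet (C n) := by
    intro n
    simp only [C]
    split_ifs <;> simp [hA, hB]
  have hdisj : Pairwise (fun i j => Disjoint (C i) (C j)) := by
    intro i j hij
    simp only [C]
    split_ifs <;> first | omega | exact hAB | exact hAB.symm | simp
  have h := hM.sigma_additive C hmeas
    (by rw [hC]; exact (measure_union_le A B).trans_lt (ENNReal.add_lt_top.2 ⟨hmA, hmB⟩)) hdisj
  rw [hC] at h
  filter_upwards [h, hM.ae_eq_zero hα MeasurableSet.empty measure_empty] with s hs h0
  have h2 : Tendsto (fun n : ℕ => ∑ i ∈ Finset.range n, M (C i) s) atTop (𝓝 (M A s + M B s)) := by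
    refine tendsto_const_nhds.congr' ?_
    filter_upwards [eventually_ge_atTop 2] with n hn
    obtain ⟨k, rfl⟩ := Nat.exists_eq_add_of_le hn
    rw [Finset.sum_range_add, Finset.sum_range_succ, Finset.sum_range_one]
    have : ∀ i ∈ Finset.range k, M (C (2 + i)) s = 0 := by
      intro i _
      have : C (2 + i) = ∅ := by
        simp only [C]
        rw [if_neg (by omega), if_neg (by omega)]
      rw [this]; exact h0
    rw [Finset.sum_eq_zero this]
    simp [C]
  exact tendsto_nhds_unique hs h2

theorem biUnion_finset (hM : IsSymmetricStableRandomMeasure P α m M) (hα : 0 < α) {ι : Type*}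
    (t : Finset ι) (A : ι → Set E) (hA : ∀ i ∈ t, MeasurableSet (A i)) (hmA : ∀ i ∈ t, m (A i) < ⊤)
    (hd : (t : Set ι).PairwiseDisjoint A) :
    M (⋃ i ∈ t, A i) =ᵐ[P] fun s => ∑ i ∈ t, M (A i) s := by
  classical
  induction t using Finset.induction_on with
  | empty =>
    filter_upwards [hM.ae_eq_zero hα MeasurableSet.empty measure_empty] with s hs
    simpa using hs
  | insert i t hi ih =>
    have ih := ih (fun j hj => hA j (Finset.mem_insert_of_mem hj))
      (fun j hj => hmA j (Finset.mem_insert_of_mem hj))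
      (hd.subset (by simp))
    rw [Finset.set_biUnion_insert]
    have h1 := hM.union hα (B := ⋃ j ∈ t, A j) (hA i (Finset.mem_insert_self i t))
      (Finset.measurableSet_biUnion t fun j hj => hA j (Finset.mem_insert_of_mem hj)) ?_
      (hmA i (Finset.mem_insert_self i t)) ?_
    · filter_upwards [h1, ih] with s h1 h2
      rw [h1, Pi.add_apply, h2, Finset.sum_insert hi]
    · simp only [Set.disjoint_iUnion_right]
      intro j hj
      exact hd (by simp) (by simp [hj]) (by rintro rfl; exact hi hj)
    · exact measure_biUnion_lt_top t.finite_toSet fun j hj => hmA j (Finset.mem_insert_of_mem hj)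

/-- The integral of `h ∘ ψ` may be computed along the level sets of `ψ`. -/
theorem simpleStableIntegral_map (hM : IsSymmetricStableRandomMeasure P α m M) (hα : 0 < α)
    {β : Type*} (ψ : SimpleFunc E β) (h : β → ℝ) (hfin : (ψ.map h).FinMeasSupp m) :
    simpleStableIntegral M (ψ.map h) =ᵐ[P]
      fun s => ∑ b ∈ ψ.range, h b * M (ψ ⁻¹' {b}) s := by
  classical
  have key : ∀ y ∈ (ψ.map h).range, ∀ᵐ s ∂P, y * M ((ψ.map h) ⁻¹' {y}) s =
      ∑ b ∈ ψ.range with h b = y, h b * M (ψ ⁻¹' {b}) s := by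
    intro y _
    -- The zero level set may have infinite measure, where `M` is arbitrary; the factor 0 removes
    -- it.
    by_cases hy : y = 0
    · refine Eventually.of_forall fun s => ?_
      rw [hy, zero_mul]
      refine (Finset.sum_eq_zero fun b hb => ?_).symm
      rw [(Finset.mem_filter.1 hb).2, zero_mul]
    · have hpre : (ψ.map h) ⁻¹' {y} = ⋃ b ∈ ψ.range.filter (fun b => h b = y), ψ ⁻¹' {b} := by
        rw [SimpleFunc.map_preimage_singleton]
        ext x
        simp
      have hm := SimpleFunc.finMeasSupp_iff.1 hfin y hy
      have := hM.biUnion_finset hα (ψ.range.filter (fun b => h b = y)) (fun b => ψ ⁻¹' {b})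
        (fun b _ => ψ.measurableSet_fiber b) (fun b hb => (measure_mono ?_).trans_lt hm) ?_
      · rw [← hpre] at this
        filter_upwards [this] with s hs
        rw [hs, Finset.mul_sum]
        refine Finset.sum_congr rfl fun b hb => ?_
        rw [(Finset.mem_filter.1 hb).2]
      · rw [hpre]
        exact Set.subset_biUnion_of_mem (u := fun b => ψ ⁻¹' {b}) hb
      · intro b _ b' _ hbb'
        exact Disjoint.preimage _ (by simpa using hbb')
  filter_upwards [(ae_ball_iff (Finset.countable_toSet _)).2 key] with s hs
  rw [simpleStableIntegral, Finset.sum_congr rfl hs, SimpleFunc.range_map]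
  exact Finset.sum_fiberwise_of_maps_to (fun b hb => Finset.mem_image_of_mem h hb) _

/-- All three integrals are computed along the common refinement given by the level sets of `φ.pair
ψ`, where additivity is termwise. -/
theorem simpleStableIntegral_add (hM : IsSymmetricStableRandomMeasure P α m M) (hα : 0 < α)
    {φ ψ : SimpleFunc E ℝ} (hφ : φ.FinMeasSupp m) (hψ : ψ.FinMeasSupp m) :
    simpleStableIntegral M (φ + ψ) =ᵐ[P]
      simpleStableIntegral M φ + simpleStableIntegral M ψ := by
  have e : ∀ (h : ℝ × ℝ → ℝ) (ξ : SimpleFunc E ℝ), ξ.FinMeasSupp m → (φ.pair ψ).map h = ξ →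
      simpleStableIntegral M ξ =ᵐ[P]
        fun s => ∑ b ∈ (φ.pair ψ).range, h b * M ((φ.pair ψ) ⁻¹' {b}) s := by
    rintro h ξ hξ rfl
    exact hM.simpleStableIntegral_map hα _ h hξ
  filter_upwards [e Prod.fst φ hφ rfl, e Prod.snd ψ hψ rfl,
    e (fun p => p.1 + p.2) (φ + ψ) (hφ.add hψ) rfl] with s h1 h2 h3
  rw [h3, Pi.add_apply, h1, h2, ← Finset.sum_add_distrib]
  exact Finset.sum_congr rfl fun b _ => add_mul _ _ _

theorem simpleStableIntegral_sub (hM : IsSymmetricStableRandomMeasure P α m M) (hα : 0 < α)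
    {φ ψ : SimpleFunc E ℝ} (hφ : φ.FinMeasSupp m) (hψ : ψ.FinMeasSupp m) :
    simpleStableIntegral M (φ - ψ) =ᵐ[P]
      simpleStableIntegral M φ - simpleStableIntegral M ψ := by
  have hsub : (φ - ψ).FinMeasSupp m := (hφ.pair hψ).map (g := fun p : ℝ × ℝ => p.1 - p.2) (by simp)
  filter_upwards [hM.simpleStableIntegral_add hα hsub hψ] with s hs
  rw [sub_add_cancel, Pi.add_apply] at hs
  rw [Pi.sub_apply, hs, add_sub_cancel_right]

theorem simpleStableIntegral_restrict_const (hM : IsSymmetricStableRandomMeasure P α m M)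
    (hα : 0 < α) {A : Set E} (hA : MeasurableSet A) (c : ℝ) :
    simpleStableIntegral M ((SimpleFunc.const E c).restrict A) =ᵐ[P] fun s => c * M A s := by
  classical
  by_cases hc : c = 0
  · have : (SimpleFunc.const E c).restrict A = (SimpleFunc.const E (0 : ℝ)) := by
      ext x; simp [SimpleFunc.restrict_apply _ hA, hc]
    rw [this, hc]
    refine Eventually.of_forall fun s => ?_
    simp only [simpleStableIntegral, zero_mul]
    refine Finset.sum_eq_zero fun y hy => ?_
    obtain ⟨x, rfl⟩ := SimpleFunc.mem_range.1 hy
    simp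
  · have hpre : ((SimpleFunc.const E c).restrict A) ⁻¹' {c} = A := by
      rw [SimpleFunc.restrict_preimage _ hA (by simpa using Ne.symm hc)]
      ext x; simp
    have hval : ∀ y ∈ ((SimpleFunc.const E c).restrict A).range, y ≠ c → y = 0 := by
      intro y hy hyc
      obtain ⟨x, rfl⟩ := SimpleFunc.mem_range.1 hy
      rw [SimpleFunc.restrict_apply _ hA] at hyc ⊢
      by_cases hx : x ∈ A
      · simp [hx] at hyc
      · simp [hx]
    by_cases hcr : c ∈ ((SimpleFunc.const E c).restrict A).range
    · refine Eventually.of_forall fun s => ?_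
      simp only [simpleStableIntegral]
      rw [Finset.sum_eq_single_of_mem c hcr, hpre]
      intro y hy hyc
      rw [hval y hy hyc, zero_mul]
    · have hAe : A = ∅ := by
        rw [← hpre]
        exact SimpleFunc.preimage_eq_empty_iff _ _ |>.2 hcr
      filter_upwards [hM.ae_eq_zero hα hA (by simp [hAe])] with s hs
      rw [hs, Pi.zero_apply, mul_zero, simpleStableIntegral]
      refine Finset.sum_eq_zero fun y hy => ?_
      rw [hval y hy (by rintro rfl; exact hcr hy), zero_mul]

theorem finMeasSupp_restrict_const {A : Set E} (hA : MeasurableSet A) (hmA : m A < ⊤) (c : ℝ) :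
    ((SimpleFunc.const E c).restrict A).FinMeasSupp m := by
  rw [SimpleFunc.finMeasSupp_iff_support]
  refine (measure_mono ?_).trans_lt hmA
  rw [SimpleFunc.coe_restrict _ hA]
  exact Set.support_indicator_subset

theorem simpleStableIntegral_sum_restrict_const (hM : IsSymmetricStableRandomMeasure P α m M)
    (hα : 0 < α) {ι : Type*} (t : Finset ι) (A : ι → Set E) (c : ι → ℝ)
    (hA : ∀ i ∈ t, MeasurableSet (A i)) (hmA : ∀ i ∈ t, m (A i) < ⊤) :
    (∑ i ∈ t, (SimpleFunc.const E (c i)).restrict (A i)).FinMeasSupp m ∧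
    simpleStableIntegral M (∑ i ∈ t, (SimpleFunc.const E (c i)).restrict (A i)) =ᵐ[P]
      fun s => ∑ i ∈ t, c i * M (A i) s := by
  classical
  induction t using Finset.induction_on with
  | empty =>
    refine ⟨by simp [SimpleFunc.finMeasSupp_iff_support], Eventually.of_forall fun s => ?_⟩
    simp only [Finset.sum_empty, simpleStableIntegral]
    refine Finset.sum_eq_zero fun y hy => ?_
    obtain ⟨x, rfl⟩ := SimpleFunc.mem_range.1 hy
    simp
  | insert i t hi ih =>
    obtain ⟨ih1, ih2⟩ := ih (fun j hj => hA j (Finset.mem_insert_of_mem hj))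
      (fun j hj => hmA j (Finset.mem_insert_of_mem hj))
    have hAi := hA i (Finset.mem_insert_self i t)
    have hmi := hmA i (Finset.mem_insert_self i t)
    have h1 := finMeasSupp_restrict_const hAi hmi (c i)
    simp only [Finset.sum_insert hi]
    refine ⟨h1.add ih1, ?_⟩
    filter_upwards [hM.simpleStableIntegral_add hα h1 ih1, ih2,
      hM.simpleStableIntegral_restrict_const hα hAi (c i)] with s h1 h2 h3
    rw [h1, Pi.add_apply, h2, h3]

omit [IsProbabilityMeasure P] in
theorem measurable_simpleStableIntegral (hM : IsSymmetricStableRandomMeasure P α m M)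
    {φ : SimpleFunc E ℝ} (hφ : φ.FinMeasSupp m) : Measurable (simpleStableIntegral M φ) := by
  refine Finset.measurable_fun_sum _ fun y _ => ?_
  by_cases hy : y = 0
  · simp [hy]
  · exact (hM.measurable _ (φ.measurableSet_fiber y)
      (SimpleFunc.finMeasSupp_iff.1 hφ y hy)).const_mul y

omit [IsProbabilityMeasure P] in
-- Level sets are disjoint, so the summands are independent, characteristic functions multiply, and
-- the exponents add up to `∫ |φ| ^ α`.
theorem hasSymmetricStableLaw_simpleStableIntegral (hM : IsSymmetricStableRandomMeasure P α m M)
    (hα : 0 < α) {φ : SimpleFunc E ℝ} (hφ : φ.FinMeasSupp m) :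
    HasSymmetricStableLaw P α ((∫⁻ x, ‖φ x‖ₑ ^ α ∂m).toReal ^ (1 / α))
      (simpleStableIntegral M φ) := by
  classical
  rw [hasSymmetricStableLaw_rpow_iff hα ENNReal.toReal_nonneg]
  refine ⟨(hM.measurable_simpleStableIntegral hφ).aemeasurable, fun θ => ?_⟩
  set t := φ.range.filter (fun y => y ≠ 0) with ht
  have hfin : ∀ y ∈ t, m (φ ⁻¹' {y}) < ⊤ := fun y hy =>
    SimpleFunc.finMeasSupp_iff.1 hφ y (Finset.mem_filter.1 hy).2
  have hX : simpleStableIntegral M φ = fun s => ∑ y ∈ t, y * M (φ ⁻¹' {y}) s := by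
    ext s
    simp only [simpleStableIntegral]
    refine (Finset.sum_subset (Finset.filter_subset _ _) fun y hy hy' => ?_).symm
    have : y = 0 := by simpa [ht, hy] using hy'
    rw [this, zero_mul]
  have hV : ∫⁻ x, ‖φ x‖ₑ ^ α ∂m = ∑ y ∈ t, ‖y‖ₑ ^ α * m (φ ⁻¹' {y}) := by
    have : ∫⁻ x, ‖φ x‖ₑ ^ α ∂m = (φ.map fun y => ‖y‖ₑ ^ α).lintegral m := by
      rw [← SimpleFunc.lintegral_eq_lintegral]; rfl
    rw [this, SimpleFunc.map_lintegral]
    refine (Finset.sum_subset (Finset.filter_subset _ _) fun y hy hy' => ?_).symm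
    have : y = 0 := by simpa [ht, hy] using hy'
    simp [this, ENNReal.zero_rpow_of_pos hα]
  have hV' : (∫⁻ x, ‖φ x‖ₑ ^ α ∂m).toReal = ∑ y ∈ t, |y| ^ α * (m (φ ⁻¹' {y})).toReal := by
    rw [hV, ENNReal.toReal_sum]
    · refine Finset.sum_congr rfl fun y _ => ?_
      rw [ENNReal.toReal_mul, ← ENNReal.toReal_rpow, toReal_enorm, Real.norm_eq_abs]
    · intro y hy
      exact ENNReal.mul_ne_top (ENNReal.rpow_ne_top_of_nonneg hα.le enorm_ne_top) (hfin y hy).ne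
  have hindep : iIndepFun (t.restrict fun y s => y * M (φ ⁻¹' {y}) s) P := by
    have h1 := hM.indep t.card (fun i => φ ⁻¹' {(t.equivFin.symm i : ℝ)})
      (fun i => φ.measurableSet_fiber _) (fun i => hfin _ (t.equivFin.symm i).2)
      (fun i j hij => Disjoint.preimage _ (by
        simpa [Subtype.ext_iff] using fun h => hij (t.equivFin.symm.injective (Subtype.ext h))))
    have h2 := h1.precomp t.equivFin.injective
    have h3 := h2.comp (fun y x => (y : ℝ) * x) (fun y => measurable_const_mul _)
    convert h3 using 1
    ext y s
    simp
  rw [hX, hindep.charFun_map_fun_finsetSum_eq_prod (fun y hy =>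
    ((hM.measurable _ (φ.measurableSet_fiber y) (hfin y hy)).const_mul y).aemeasurable),
    Finset.prod_apply]
  have hfac : ∀ y ∈ t, charFun (P.map fun s => y * M (φ ⁻¹' {y}) s) θ =
      Complex.exp (-(((|y| ^ α * (m (φ ⁻¹' {y})).toReal) * |θ| ^ α : ℝ) : ℂ)) := by
    intro y hy
    have hlaw := ((hasSymmetricStableLaw_rpow_iff hα ENNReal.toReal_nonneg).1
      (hM.law _ (φ.measurableSet_fiber y) (hfin y hy)))
    rw [charFun_map_mul_comp hlaw.1, hlaw.2, abs_mul,
      Real.mul_rpow (abs_nonneg _) (abs_nonneg _)]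
    congr 3
    ring
  rw [Finset.prod_congr rfl hfac, ← Complex.exp_sum, hV', Finset.sum_mul]
  push_cast
  rw [Finset.sum_neg_distrib]

end IsSymmetricStableRandomMeasure

/-! ### The `L ^ α` quasi-norm, for all `α > 0`. -/

section PowLIntegral

/-- The `α`-th power `∫ |f| ^ α dm` of the `L ^ α`-(quasi-)norm. -/
noncomputable def powLIntegral {E : Type*} [MeasurableSpace E] (α : ℝ) (m : Measure E)
    (f : E → ℝ) : ENNReal :=
  ∫⁻ x, ‖f x‖ₑ ^ α ∂m

variable {E : Type*} [MeasurableSpace E] {m : Measure E} {α : ℝ}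

theorem eLpNorm_ofReal_eq_powLIntegral (hα : 0 < α) (f : E → ℝ) :
    eLpNorm f (ENNReal.ofReal α) m = powLIntegral α m f ^ (1 / α) := by
  rw [eLpNorm_eq_lintegral_rpow_enorm_toReal (by simpa using hα) ENNReal.ofReal_ne_top,
    ENNReal.toReal_ofReal hα.le]
  rfl

theorem powLIntegral_eq_eLpNorm_rpow (hα : 0 < α) (f : E → ℝ) :
    powLIntegral α m f = eLpNorm f (ENNReal.ofReal α) m ^ α := by
  rw [eLpNorm_ofReal_eq_powLIntegral hα, ← ENNReal.rpow_mul, one_div_mul_cancel hα.ne',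
    ENNReal.rpow_one]

theorem MeasureTheory.MemLp.powLIntegral_lt_top (hα : 0 < α) {f : E → ℝ}
    (hf : MemLp f (ENNReal.ofReal α) m) : powLIntegral α m f < ⊤ := by
  rw [powLIntegral_eq_eLpNorm_rpow hα]
  exact ENNReal.rpow_lt_top_of_nonneg hα.le hf.eLpNorm_ne_top

theorem memLp_of_finMeasSupp (hα : 0 < α) {φ : SimpleFunc E ℝ} (hφ : φ.FinMeasSupp m) :
    MemLp φ (ENNReal.ofReal α) m :=
  (SimpleFunc.memLp_iff_finMeasSupp (by simpa using hα) ENNReal.ofReal_ne_top).2 hφ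

theorem powLIntegral_sub_comm (f g : E → ℝ) :
    powLIntegral α m (fun x => f x - g x) = powLIntegral α m (fun x => g x - f x) := by
  refine lintegral_congr fun x => ?_
  rw [← enorm_neg, neg_sub]

theorem powLIntegral_add_le (hα : 0 < α) {f g : E → ℝ} (hf : AEStronglyMeasurable f m) :
    powLIntegral α m (fun x => f x + g x) ≤
      2 ^ α * (powLIntegral α m f + powLIntegral α m g) := by
  unfold powLIntegral
  rw [← lintegral_add_left' (hf.enorm.pow_const α), ← lintegral_const_mul' _ _
    (ENNReal.rpow_ne_top_of_nonneg hα.le (by simp))]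
  refine lintegral_mono fun x => ?_
  calc ‖f x + g x‖ₑ ^ α ≤ (2 * max ‖f x‖ₑ ‖g x‖ₑ) ^ α := by
        gcongr
        refine (enorm_add_le _ _).trans ?_
        rw [two_mul]
        exact add_le_add (le_max_left _ _) (le_max_right _ _)
    _ = 2 ^ α * max ‖f x‖ₑ ‖g x‖ₑ ^ α := ENNReal.mul_rpow_of_nonneg _ _ hα.le
    _ ≤ 2 ^ α * (‖f x‖ₑ ^ α + ‖g x‖ₑ ^ α) := by
        gcongr
        rcases max_choice ‖f x‖ₑ ‖g x‖ₑ with h | h <;> rw [h]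
        · exact le_self_add
        · exact le_add_self

/-- Some power of the functional obeys the triangle inequality: the first power for `α ≤ 1`, by
subadditivity of `t ↦ t ^ α`, and the power `1 / α` for `α ≥ 1`, by Minkowski. -/
theorem exists_powLIntegral_rpow_add_le (hα : 0 < α) : ∃ r : ℝ, 0 < r ∧ ∀ f g : E → ℝ,
    AEStronglyMeasurable f m → AEStronglyMeasurable g m →
    powLIntegral α m (fun x => f x + g x) ^ r ≤
      powLIntegral α m f ^ r + powLIntegral α m g ^ r := by
  rcases le_total α 1 with h | h
  · refine ⟨1, one_pos, fun f g hf _ => ?_⟩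
    simp only [ENNReal.rpow_one]
    unfold powLIntegral
    rw [← lintegral_add_left' (hf.enorm.pow_const α)]
    refine lintegral_mono fun x => ?_
    exact (ENNReal.rpow_le_rpow (enorm_add_le _ _) hα.le).trans
      (ENNReal.rpow_add_le_add_rpow _ _ hα.le h)
  · refine ⟨1 / α, one_div_pos.2 hα, fun f g hf hg => ?_⟩
    simp only [← eLpNorm_ofReal_eq_powLIntegral hα]
    exact eLpNorm_add_le hf hg (by simpa using ENNReal.ofReal_le_ofReal h)

theorem ENNReal.tendsto_of_le_add {ι : Type*} {l : Filter ι} {a e : ι → ENNReal} {b : ENNReal}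
    (hb : b ≠ ⊤) (h1 : ∀ i, a i ≤ b + e i) (h2 : ∀ i, b ≤ a i + e i) (he : Tendsto e l (𝓝 0)) :
    Tendsto a l (𝓝 b) := by
  have hl : Tendsto (fun i => b - e i) l (𝓝 b) := by
    simpa using ENNReal.Tendsto.sub (tendsto_const_nhds (x := b)) he (Or.inl hb)
  have hu : Tendsto (fun i => b + e i) l (𝓝 b) := by
    simpa using (tendsto_const_nhds (x := b)).add he
  exact tendsto_of_tendsto_of_tendsto_of_le_of_le hl hu
    (fun i => tsub_le_iff_right.2 (h2 i)) h1

theorem tendsto_powLIntegral (hα : 0 < α) {ι : Type*} {l : Filter ι} {u : ι → E → ℝ} {v : E → ℝ}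
    (hu : ∀ i, AEStronglyMeasurable (u i) m) (hv : AEStronglyMeasurable v m)
    (hfin : powLIntegral α m v ≠ ⊤)
    (h : Tendsto (fun i => powLIntegral α m (fun x => u i x - v x)) l (𝓝 0)) :
    Tendsto (fun i => powLIntegral α m (u i)) l (𝓝 (powLIntegral α m v)) := by
  obtain ⟨r, hr, hadd⟩ := exists_powLIntegral_rpow_add_le (m := m) hα
  have h0 : Tendsto (fun i => powLIntegral α m (fun x => u i x - v x) ^ r) l (𝓝 0) := by
    simpa [ENNReal.zero_rpow_of_pos hr] using h.ennrpow_const r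
  have key : Tendsto (fun i => powLIntegral α m (u i) ^ r) l (𝓝 (powLIntegral α m v ^ r)) := by
    refine ENNReal.tendsto_of_le_add (ENNReal.rpow_ne_top_of_nonneg hr.le hfin)
      (fun i => ?_) (fun i => ?_) h0
    · simpa using hadd v (fun x => u i x - v x) hv ((hu i).sub hv)
    · have := hadd (u i) (fun x => v x - u i x) (hu i) (hv.sub (hu i))
      rw [powLIntegral_sub_comm v] at this
      simpa using this
  have := key.ennrpow_const r⁻¹
  simpa only [← ENNReal.rpow_mul, mul_inv_cancel₀ hr.ne', ENNReal.rpow_one] using this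

end PowLIntegral

/-! ### Tail bounds and limits of characteristic functions. -/

/-- The truncation inequality bounds the tail by an average of `1 - charFun` over `|t| ≤ 2 / r`, and
`1 - exp (-x) ≤ x`. Thus smallness in `L ^ α` gives smallness in probability. -/
theorem HasSymmetricStableLaw.measureReal_lt_abs_le {S : Type*} [MeasurableSpace S] {P : Measure S}
    [IsProbabilityMeasure P] {α v r : ℝ} {X : S → ℝ} (hα : 0 < α) (hv : 0 ≤ v) (hr : 0 < r)
    (h : HasSymmetricStableLaw P α (v ^ (1 / α)) X) :
    P.real {s | r < |X s|} ≤ 2 * v * (2 / r) ^ α := by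
  obtain ⟨hX, hφ⟩ := (hasSymmetricStableLaw_rpow_iff hα hv).1 h
  have := Measure.isProbabilityMeasure_map hX
  have h1 := measureReal_abs_gt_le_integral_charFun (μ := P.map X) hr
  have hms : MeasurableSet {x : ℝ | r < |x|} := measurableSet_lt measurable_const measurable_id.abs
  rw [map_measureReal_apply_of_aemeasurable hX hms] at h1
  have hb : ∀ t ∈ Set.uIoc (-2 * r⁻¹) (2 * r⁻¹),
      ‖1 - charFun (P.map X) t‖ ≤ v * (2 / r) ^ α := by
    intro t ht
    rw [Set.uIoc_of_le (by have := inv_pos.2 hr; linarith)] at ht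
    have htr : |t| ≤ 2 / r := by
      rw [div_eq_mul_inv, abs_le]
      exact ⟨by linarith [ht.1], ht.2⟩
    have h0 : 0 ≤ v * |t| ^ α := by positivity
    rw [hφ t, ← Complex.ofReal_neg, ← Complex.ofReal_exp, ← Complex.ofReal_one,
      ← Complex.ofReal_sub, Complex.norm_real, Real.norm_eq_abs,
      abs_of_nonneg (by simpa using h0)]
    have := Real.one_sub_le_exp_neg (v * |t| ^ α)
    have h2 : v * |t| ^ α ≤ v * (2 / r) ^ α := by gcongr
    linarith
  have h2 := intervalIntegral.norm_integral_le_of_norm_le_const hb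
  have h3 : |2 * r⁻¹ - -2 * r⁻¹| = 4 * r⁻¹ := by
    rw [abs_of_nonneg (by have := inv_pos.2 hr; linarith)]; ring
  rw [h3] at h2
  calc P.real {s | r < |X s|} ≤ _ := h1
    _ ≤ 2⁻¹ * r * (v * (2 / r) ^ α * (4 * r⁻¹)) := by gcongr
    _ = 2 * v * (2 / r) ^ α := by field_simp; ring

theorem tendsto_charFun_map_of_tendsto_ae {S : Type*} [MeasurableSpace S] {P : Measure S}
    [IsFiniteMeasure P] {X : ℕ → S → ℝ} {Y : S → ℝ} (hX : ∀ n, AEMeasurable (X n) P)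
    (hY : AEMeasurable Y P) (h : ∀ᵐ s ∂P, Tendsto (fun n => X n s) atTop (𝓝 (Y s))) (θ : ℝ) :
    Tendsto (fun n => charFun (P.map (X n)) θ) atTop (𝓝 (charFun (P.map Y) θ)) := by
  have hc : Continuous fun x : ℝ => Complex.exp (θ * x * Complex.I) := by fun_prop
  have e : ∀ Z : S → ℝ, AEMeasurable Z P →
      charFun (P.map Z) θ = ∫ s, Complex.exp (θ * Z s * Complex.I) ∂P := by
    intro Z hZ
    rw [charFun_apply_real, integral_map hZ hc.aestronglyMeasurable]
  simp only [e Y hY, fun n => e (X n) (hX n)]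
  refine tendsto_integral_of_dominated_convergence (fun _ => 1) (fun n => ?_)
    (integrable_const _) (fun n => ?_) ?_
  · exact (hc.measurable.comp_aemeasurable (hX n)).aestronglyMeasurable
  · refine Eventually.of_forall fun s => ?_
    rw [← Complex.ofReal_mul, Complex.norm_exp_ofReal_mul_I]
  · filter_upwards [h] with s hs
    exact (hc.tendsto _).comp hs

/-! ### The stochastic integral: existence and law. -/

namespace IsSymmetricStableRandomMeasure

variable {S E : Type*} [MeasurableSpace S] [MeasurableSpace E] {P : Measure S}
  [IsProbabilityMeasure P] {α : ℝ} {m : Measure E} {M : Set E → S → ℝ}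

theorem hasSymmetricStableLaw_sub (hM : IsSymmetricStableRandomMeasure P α m M)
    (hα : 0 < α) {φ ψ : SimpleFunc E ℝ} (hφ : φ.FinMeasSupp m) (hψ : ψ.FinMeasSupp m) :
    HasSymmetricStableLaw P α ((powLIntegral α m (fun x => φ x - ψ x)).toReal ^ (1 / α))
      (simpleStableIntegral M φ - simpleStableIntegral M ψ) := by
  have hsub : (φ - ψ).FinMeasSupp m := (hφ.pair hψ).map (g := fun p : ℝ × ℝ => p.1 - p.2) (by simp)
  exact (hM.hasSymmetricStableLaw_simpleStableIntegral hα hsub).congr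
    (hM.simpleStableIntegral_sub hα hφ hψ)

/-- Existence of the stochastic integral. -/
theorem exists_isStableIntegral (hM : IsSymmetricStableRandomMeasure P α m M) (hα : 0 < α)
    {f : E → ℝ} (hf : MemLp f (ENNReal.ofReal α) m) : ∃ X, IsStableIntegral P α m M f X := by
  -- With errors `τ ^ n`, the tail bound at threshold `2⁻¹ ^ n` is of order `τ ^ n * (2 ^ α) ^ n =
  -- 2⁻¹ ^ n`, which is summable.
  set τ : ℝ := 2⁻¹ / 2 ^ α with hτ
  have h2α : (1 : ℝ) < 2 ^ α := Real.one_lt_rpow (by norm_num) hα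
  have hτ0 : 0 < τ := by positivity
  have hτ1 : τ < 1 := by
    rw [hτ, div_lt_one (by positivity)]; linarith
  have hex : ∀ n : ℕ, ∃ φ : SimpleFunc E ℝ, φ.FinMeasSupp m ∧
      powLIntegral α m (fun x => φ x - f x) ≤ ENNReal.ofReal (τ ^ n) := by
    intro n
    obtain ⟨φ, h1, h2⟩ := hf.exists_simpleFunc_eLpNorm_sub_lt ENNReal.ofReal_ne_top
      (ε := ENNReal.ofReal (τ ^ n) ^ (1 / α))
      (by
        rw [Ne, ENNReal.rpow_eq_zero_iff_of_pos (one_div_pos.2 hα), ENNReal.ofReal_eq_zero, not_le]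
        positivity)
    refine ⟨φ, (SimpleFunc.memLp_iff_finMeasSupp (by simpa using hα) ENNReal.ofReal_ne_top).1 h2,
      ?_⟩
    rw [eLpNorm_ofReal_eq_powLIntegral hα] at h1
    rw [powLIntegral_sub_comm]
    exact ((ENNReal.rpow_lt_rpow_iff (one_div_pos.2 hα)).1 h1).le
  choose φ hφ hφf using hex
  have hV0 : Tendsto (fun n => powLIntegral α m (fun x => φ n x - f x)) atTop (𝓝 0) := by
    refine tendsto_of_tendsto_of_tendsto_of_le_of_le tendsto_const_nhds ?_ (fun _ => zero_le) hφf
    simpa using ENNReal.tendsto_ofReal (tendsto_pow_atTop_nhds_zero_of_lt_one hτ0.le hτ1)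
  set X : ℕ → S → ℝ := fun n => simpleStableIntegral M (φ n) with hX
  have hXm : ∀ n, Measurable (X n) := fun n => hM.measurable_simpleStableIntegral (hφ n)
  have hv : ∀ n, (powLIntegral α m (fun x => φ n x - φ (n + 1) x)).toReal ≤
      2 ^ α * 2 * τ ^ n := by
    intro n
    refine ENNReal.toReal_le_of_le_ofReal (by positivity) ?_
    have h1 : (fun x => φ n x - φ (n + 1) x) =
        fun x => (φ n x - f x) + (f x - φ (n + 1) x) := by ext x; ring
    rw [h1]
    refine (powLIntegral_add_le hα ((φ n).aestronglyMeasurable.sub hf.1)).trans ?_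
    rw [powLIntegral_sub_comm f, mul_assoc, ENNReal.ofReal_mul (by positivity),
      ← ENNReal.ofReal_rpow_of_pos two_pos, ENNReal.ofReal_ofNat, two_mul,
      ENNReal.ofReal_add (by positivity) (by positivity)]
    gcongr
    · exact hφf n
    · refine (hφf (n + 1)).trans (ENNReal.ofReal_le_ofReal ?_)
      exact pow_le_pow_of_le_one hτ0.le hτ1.le (Nat.le_succ n)
  have htail : ∀ n, P {s | (2⁻¹ : ℝ) ^ n < |(X n - X (n + 1)) s|} ≤
      ENNReal.ofReal (2 * (2 ^ α * 2) * 2 ^ α * 2⁻¹ ^ n) := by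
    intro n
    have h1 := (hM.hasSymmetricStableLaw_sub hα (hφ n) (hφ (n + 1))).measureReal_lt_abs_le hα
      ENNReal.toReal_nonneg (r := 2⁻¹ ^ n) (by positivity)
    rw [← ofReal_measureReal]
    refine ENNReal.ofReal_le_ofReal (h1.trans ?_)
    have h2 : ((2 : ℝ) / 2⁻¹ ^ n) ^ α = 2 ^ α * (2 ^ α) ^ n := by
      rw [inv_pow, div_inv_eq_mul, Real.mul_rpow (by norm_num) (by positivity),
        ← Real.rpow_natCast_mul (by norm_num), mul_comm (n : ℝ), Real.rpow_mul_natCast (by norm_num)]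
    have h3 : τ ^ n * (2 ^ α) ^ n = 2⁻¹ ^ n := by
      rw [← mul_pow, hτ, div_mul_cancel₀ _ (by positivity)]
    rw [h2]
    calc _ ≤ 2 * (2 ^ α * 2 * τ ^ n) * (2 ^ α * (2 ^ α) ^ n) := by
          gcongr
          exact hv n
      _ = 2 * (2 ^ α * 2) * 2 ^ α * (τ ^ n * (2 ^ α) ^ n) := by ring
      _ = _ := by rw [h3]
  have hsum : ∑' n, P {s | (2⁻¹ : ℝ) ^ n < |(X n - X (n + 1)) s|} ≠ ⊤ := by
    refine ne_top_of_le_ne_top ?_ (ENNReal.tsum_le_tsum htail)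
    refine Summable.tsum_ofReal_ne_top ?_
    exact (summable_geometric_of_lt_one (by norm_num) (by norm_num)).mul_left _
  -- Borel–Cantelli: almost surely, consecutive differences are eventually at most `2⁻¹ ^ n`, so the
  -- sequence is Cauchy.
  have hlim : ∀ᵐ s ∂P, ∃ l, Tendsto (fun n => X n s) atTop (𝓝 l) := by
    filter_upwards [ae_eventually_notMem hsum] with s hs
    refine cauchySeq_tendsto_of_complete (cauchySeq_of_summable_dist ?_)
    refine Summable.of_norm_bounded_eventually_nat
      (g := fun n => (2⁻¹ : ℝ) ^ n) (summable_geometric_of_lt_one (by norm_num) (by norm_num)) ?_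
    filter_upwards [hs] with n hn
    replace hn := not_lt.1 hn
    simpa [Real.dist_eq] using hn
  obtain ⟨Y, hY, hYlim⟩ := measurable_limit_of_tendsto_metrizable_ae
    (fun n => (hXm n).aemeasurable) hlim
  refine ⟨Y, hY, φ, hφ, ?_, tendstoInMeasure_of_tendsto_ae
    (fun n => (hXm n).aestronglyMeasurable) hYlim⟩
  simp only [eLpNorm_ofReal_eq_powLIntegral hα]
  simpa [ENNReal.zero_rpow_of_pos (inv_pos.2 hα)] using hV0.ennrpow_const (1 / α)

/-- The law of the difference of a stochastic integral and the integral of a simple function. -/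
theorem hasSymmetricStableLaw_isStableIntegral_sub (hM : IsSymmetricStableRandomMeasure P α m M)
    (hα : 0 < α) {f : E → ℝ} (hf : MemLp f (ENNReal.ofReal α) m) {X : S → ℝ}
    (hX : IsStableIntegral P α m M f X) {ψ : SimpleFunc E ℝ} (hψ : ψ.FinMeasSupp m) :
    HasSymmetricStableLaw P α ((powLIntegral α m (fun x => f x - ψ x)).toReal ^ (1 / α))
      (X - simpleStableIntegral M ψ) := by
  obtain ⟨hXm, φ, hφ, hφf, hlim⟩ := hX
  obtain ⟨ns, hns, hae⟩ := hlim.exists_seq_tendsto_ae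
  have hψm := hM.measurable_simpleStableIntegral hψ
  rw [hasSymmetricStableLaw_rpow_iff hα ENNReal.toReal_nonneg]
  refine ⟨(hXm.sub hψm).aemeasurable, fun θ => ?_⟩
  have hfψ := hf.sub (memLp_of_finMeasSupp hα hψ)
  have hV0 : Tendsto (fun n => powLIntegral α m (fun x => (φ n x - ψ x) - (f x - ψ x)))
      atTop (𝓝 0) := by
    simp only [sub_sub_sub_cancel_right, powLIntegral_eq_eLpNorm_rpow hα]
    simpa [ENNReal.zero_rpow_of_pos hα] using hφf.ennrpow_const α
  have hV := tendsto_powLIntegral hα (u := fun n x => φ n x - ψ x) (v := fun x => f x - ψ x)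
    (fun n => (φ n).aestronglyMeasurable.sub ψ.aestronglyMeasurable) hfψ.1
    (hfψ.powLIntegral_lt_top hα).ne hV0
  have hV' := ((ENNReal.tendsto_toReal (hfψ.powLIntegral_lt_top hα).ne).comp hV).comp
    hns.tendsto_atTop
  have h1 := tendsto_charFun_map_of_tendsto_ae
    (X := fun n => simpleStableIntegral M (φ (ns n)) - simpleStableIntegral M ψ)
    (Y := X - simpleStableIntegral M ψ) (P := P)
    (fun n => ((hM.measurable_simpleStableIntegral (hφ (ns n))).sub hψm).aemeasurable)
    (hXm.sub hψm).aemeasurable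
    (by filter_upwards [hae] with s hs using hs.sub_const _) θ
  -- The same characteristic functions also converge to the stable one, because their parameters
  -- converge by continuity of the `L ^ α` functional.
  refine tendsto_nhds_unique h1 ?_
  have hlaw := fun n => ((hasSymmetricStableLaw_rpow_iff hα ENNReal.toReal_nonneg).1
    (hM.hasSymmetricStableLaw_sub hα (hφ (ns n)) hψ)).2 θ
  simp only [hlaw]
  have hc : Continuous fun v : ℝ => Complex.exp (-((v * |θ| ^ α : ℝ) : ℂ)) := by fun_prop
  exact (hc.tendsto _).comp hV'

/-- Existence rules out the default value 0 of `stableIntegral`; the law does not depend on the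
version chosen. -/
theorem hasSymmetricStableLaw_stableIntegral_sub (hM : IsSymmetricStableRandomMeasure P α m M)
    (hα : 0 < α) {f : E → ℝ} (hf : MemLp f (ENNReal.ofReal α) m) {ψ : SimpleFunc E ℝ}
    (hψ : ψ.FinMeasSupp m) :
    HasSymmetricStableLaw P α ((powLIntegral α m (fun x => f x - ψ x)).toReal ^ (1 / α))
      (stableIntegral P α m M f - simpleStableIntegral M ψ) := by
  have h := hM.exists_isStableIntegral hα hf
  rw [stableIntegral, dif_pos h]
  exact hM.hasSymmetricStableLaw_isStableIntegral_sub hα hf h.choose_spec hψ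

end IsSymmetricStableRandomMeasure

/-! ### The discretization as the integral of a step function. -/

theorem IsSymmetricStableRandomMeasure.stableMotion_sub {S : Type*} [MeasurableSpace S]
    {P : Measure S} [IsProbabilityMeasure P] {α : ℝ} {M : Set ℝ → S → ℝ}
    (hM : IsSymmetricStableRandomMeasure P α volume M) (hα : 0 < α) {p q : ℝ} (hpq : p ≤ q) :
    stableMotion M q - stableMotion M p =ᵐ[P] M (Set.Ioc p q) := by
  have hadd : ∀ x y z : ℝ, x ≤ y → y ≤ z →
      M (Set.Ioc x z) =ᵐ[P] M (Set.Ioc x y) + M (Set.Ioc y z) := by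
    intro x y z hxy hyz
    rw [← Set.Ioc_union_Ioc_eq_Ioc hxy hyz]
    refine hM.union hα measurableSet_Ioc measurableSet_Ioc ?_ measure_Ioc_lt_top measure_Ioc_lt_top
    rw [Set.Ioc_disjoint_Ioc]
    simp [hxy, hyz]
  rcases le_or_gt 0 p with hp | hp
  · filter_upwards [hadd 0 p q hp hpq] with s hs
    simp only [Pi.sub_apply, Pi.add_apply, stableMotion, if_pos hp, if_pos (hp.trans hpq)] at hs ⊢
    linarith
  · rcases le_or_gt 0 q with hq | hq
    · filter_upwards [hadd p 0 q hp.le hq] with s hs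
      simp only [Pi.sub_apply, Pi.add_apply, stableMotion, if_neg hp.not_ge, if_pos hq] at hs ⊢
      linarith
    · filter_upwards [hadd p q 0 hpq hq.le] with s hs
      simp only [Pi.sub_apply, Pi.add_apply, stableMotion, if_neg hp.not_ge, if_neg hq.not_ge]
        at hs ⊢
      linarith

/-- The indices of the grid cells `[(j - 1) / ω, j / ω)` which make up `[-Ω, Ω)`. -/
noncomputable def gridIndex (ω Ω : ℕ) : Finset ℤ :=
  Finset.Icc (-((ω : ℤ) * (Ω : ℤ)) + 1) ((ω : ℤ) * (Ω : ℤ))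

/-- The endpoint of the grid cell `[(j - 1) / ω, j / ω)` farther from the origin. -/
noncomputable def gridPoint (ω : ℕ) (j : ℤ) : ℝ :=
  if j ≤ 0 then ((j : ℝ) - 1) / (ω : ℝ) else (j : ℝ) / (ω : ℝ)

/-- The reflected grid cell `{x | k - x ∈ [(j - 1) / ω, j / ω)}`. -/
def gridCell (ω : ℕ) (k j : ℤ) : Set ℝ :=
  Set.Ioc ((((ω : ℤ) * k - j : ℤ) : ℝ) / (ω : ℝ)) (((((ω : ℤ) * k - j : ℤ) : ℝ) + 1) / (ω : ℝ))

theorem measurableSet_gridCell (ω : ℕ) (k j : ℤ) : MeasurableSet (gridCell ω k j) :=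
  measurableSet_Ioc

/-- The step function on `ℝ` which approximates `x ↦ g (k - x)`. -/
noncomputable def stepApprox (g : ℝ → ℝ) (ω Ω : ℕ) (k : ℤ) : SimpleFunc ℝ ℝ :=
  ∑ j ∈ gridIndex ω Ω, (SimpleFunc.const ℝ (g (gridPoint ω j))).restrict (gridCell ω k j)

theorem movingAverageApprox_eq_sum {S : Type*} (M : Set ℝ → S → ℝ) (g : ℝ → ℝ) (ω Ω : ℕ) (k : ℤ)
    (s : S) : movingAverageApprox M g ω Ω k s =
      ∑ j ∈ gridIndex ω Ω, g (gridPoint ω j) * stableIncrement M ω ((ω : ℤ) * k - j) s := by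
  have hN : 0 ≤ (ω : ℤ) * (Ω : ℤ) := by positivity
  have hun : gridIndex ω Ω = Finset.Icc (-((ω : ℤ) * (Ω : ℤ)) + 1) 0 ∪
      Finset.Icc (1 : ℤ) ((ω : ℤ) * (Ω : ℤ)) := by
    ext j
    simp only [gridIndex, Finset.mem_union, Finset.mem_Icc]
    omega
  have hd : Disjoint (Finset.Icc (-((ω : ℤ) * (Ω : ℤ)) + 1) 0)
      (Finset.Icc (1 : ℤ) ((ω : ℤ) * (Ω : ℤ))) := by
    rw [Finset.disjoint_left]
    intro j h1 h2
    rw [Finset.mem_Icc] at h1 h2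
    omega
  rw [hun, Finset.sum_union hd, movingAverageApprox]
  congr 1
  · refine Finset.sum_congr rfl fun j hj => ?_
    rw [gridPoint, if_pos (Finset.mem_Icc.1 hj).2]
  · refine Finset.sum_congr rfl fun j hj => ?_
    rw [gridPoint, if_neg (by have := (Finset.mem_Icc.1 hj).1; omega)]

theorem IsSymmetricStableRandomMeasure.movingAverageApprox_ae_eq {S : Type*} [MeasurableSpace S]
    {P : Measure S} [IsProbabilityMeasure P] {α : ℝ} {M : Set ℝ → S → ℝ}
    (hM : IsSymmetricStableRandomMeasure P α volume M) (hα : 0 < α) (g : ℝ → ℝ) (ω Ω : ℕ) (k : ℤ) :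
    (stepApprox g ω Ω k).FinMeasSupp volume ∧
      movingAverageApprox M g ω Ω k =ᵐ[P] simpleStableIntegral M (stepApprox g ω Ω k) := by
  obtain ⟨h1, h2⟩ := hM.simpleStableIntegral_sum_restrict_const hα (gridIndex ω Ω) (gridCell ω k)
    (fun j => g (gridPoint ω j)) (fun _ _ => measurableSet_Ioc) (fun _ _ => measure_Ioc_lt_top)
  refine ⟨h1, ?_⟩
  have h3 : ∀ᵐ s ∂P, ∀ j ∈ gridIndex ω Ω,
      stableIncrement M ω ((ω : ℤ) * k - j) s = M (gridCell ω k j) s := by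
    refine (ae_ball_iff (Finset.countable_toSet _)).2 fun j _ => ?_
    exact hM.stableMotion_sub hα (by gcongr; linarith)
  filter_upwards [h2, h3] with s h2 h3
  rw [movingAverageApprox_eq_sum, stepApprox, h2]
  exact Finset.sum_congr rfl fun j hj => by rw [h3 j hj]

/-- This turns the probabilistic statement into a deterministic one: everything after it estimates
this integral. -/
theorem IsMovingAverage.hasSymmetricStableLaw_approxError {S : Type*} [MeasurableSpace S]
    {P : Measure S} [IsProbabilityMeasure P] {α : ℝ} {M : Set ℝ → S → ℝ} {g : ℝ → ℝ}
    {Y : ℝ → S → ℝ} (hY : IsMovingAverage P α M g Y)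
    (hM : IsSymmetricStableRandomMeasure P α volume M) (hα : 0 < α)
    (hg : MemLp g (ENNReal.ofReal α) volume) (ω Ω : ℕ) (k : ℤ) :
    HasSymmetricStableLaw P α
      ((powLIntegral α volume fun x => g (k - x) - stepApprox g ω Ω k x).toReal ^ (1 / α))
      (approxError M g Y ω Ω k) := by
  obtain ⟨h1, h2⟩ := hM.movingAverageApprox_ae_eq hα g ω Ω k
  have hgk : MemLp (fun x => g (k - x)) (ENNReal.ofReal α) volume :=
    hg.comp_measurePreserving (Measure.measurePreserving_sub_left volume (k : ℝ))
  refine (hM.hasSymmetricStableLaw_stableIntegral_sub hα hgk h1).congr ?_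
  filter_upwards [hY k, h2] with s h3 h4
  simp only [approxError, Pi.sub_apply]
  rw [h3, h4]

/-! ### Geometry of the grid. -/

theorem exists_mem_gridCell {ω : ℕ} (hω : 0 < ω) (Ω : ℕ) (k : ℤ) {x : ℝ}
    (hx : |k - x| < Ω) : ∃ j ∈ gridIndex ω Ω, x ∈ gridCell ω k j := by
  have hω' : (0 : ℝ) < ω := by exact_mod_cast hω
  have h1 := Int.floor_le (ω * (k - x))
  have h2 := Int.lt_floor_add_one (ω * (k - x))
  rw [abs_lt] at hx
  refine ⟨⌊ω * (k - x)⌋ + 1, ?_, ?_, ?_⟩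
  · rw [gridIndex, Finset.mem_Icc]
    constructor
    · have : -((ω : ℤ) * (Ω : ℤ)) ≤ ⌊ω * (k - x)⌋ := by
        rw [Int.le_floor]
        push_cast
        nlinarith
      omega
    · have : ⌊ω * (k - x)⌋ < (ω : ℤ) * (Ω : ℤ) := by
        rw [Int.floor_lt]
        push_cast
        nlinarith
      omega
  · rw [div_lt_iff₀ hω']
    push_cast
    nlinarith
  · rw [le_div_iff₀ hω']
    push_cast
    nlinarith

theorem pairwise_disjoint_gridCell {ω : ℕ} (hω : 0 < ω) (k : ℤ) :
    Pairwise (fun i j => Disjoint (gridCell ω k i) (gridCell ω k j)) := by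
  have hω' : (0 : ℝ) < ω := by exact_mod_cast hω
  intro i j hij
  rw [Set.disjoint_left]
  rintro x ⟨h1, h2⟩ ⟨h3, h4⟩
  rw [div_lt_iff₀ hω'] at h1 h3
  rw [le_div_iff₀ hω'] at h2 h4
  refine hij ?_
  have h5 : (i : ℝ) < j + 1 := by push_cast at *; linarith
  have h6 : (j : ℝ) < i + 1 := by push_cast at *; linarith
  norm_cast at h5 h6
  omega

theorem stepApprox_apply (g : ℝ → ℝ) (ω Ω : ℕ) (k : ℤ) (x : ℝ) :
    stepApprox g ω Ω k x =
      ∑ j ∈ gridIndex ω Ω, (gridCell ω k j).indicator (fun _ => g (gridPoint ω j)) x := by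
  have h : ∀ t : Finset ℤ,
      (∑ j ∈ t, (SimpleFunc.const ℝ (g (gridPoint ω j))).restrict (gridCell ω k j)) x =
        ∑ j ∈ t, (gridCell ω k j).indicator (fun _ => g (gridPoint ω j)) x := by
    intro t
    induction t using Finset.induction_on with
    | empty => simp
    | insert i t hi ih =>
      rw [Finset.sum_insert hi, Finset.sum_insert hi, SimpleFunc.add_apply, ih,
        SimpleFunc.restrict_apply _ (measurableSet_gridCell ω k i)]
      rfl
  exact h _

theorem stepApprox_of_mem (g : ℝ → ℝ) {ω : ℕ} (hω : 0 < ω) {Ω : ℕ} {k j : ℤ} {x : ℝ}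
    (hj : j ∈ gridIndex ω Ω) (hx : x ∈ gridCell ω k j) :
    stepApprox g ω Ω k x = g (gridPoint ω j) := by
  rw [stepApprox_apply, Finset.sum_eq_single_of_mem j hj, Set.indicator_of_mem hx]
  intro i _ hij
  exact Set.indicator_of_notMem
    (fun hi => Set.disjoint_left.1 (pairwise_disjoint_gridCell hω k hij) hi hx) _

theorem stepApprox_of_notMem (g : ℝ → ℝ) {ω Ω : ℕ} {k : ℤ} {x : ℝ}
    (hx : ∀ j ∈ gridIndex ω Ω, x ∉ gridCell ω k j) : stepApprox g ω Ω k x = 0 := by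
  rw [stepApprox_apply]
  exact Finset.sum_eq_zero fun j hj => Set.indicator_of_notMem (hx j hj) _

/-- The distance of `gridPoint ω j` from the origin, in units of `1 / ω`. -/
noncomputable def gridDist (j : ℤ) : ℝ := if j ≤ 0 then 1 - (j : ℝ) else j

theorem one_le_gridDist (j : ℤ) : 1 ≤ gridDist j := by
  unfold gridDist
  split_ifs with h
  · have : (j : ℝ) ≤ 0 := by exact_mod_cast h
    linarith
  · exact_mod_cast (by omega : 1 ≤ j)

theorem abs_gridPoint {ω : ℕ} (j : ℤ) : |gridPoint ω j| = gridDist j / ω := by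
  have h := one_le_gridDist j
  unfold gridDist at h ⊢
  unfold gridPoint
  split_ifs at h ⊢ with hj
  · rw [abs_div, Nat.abs_cast, abs_sub_comm, abs_of_nonneg (by linarith)]
  · rw [abs_div, Nat.abs_cast, abs_of_nonneg (by linarith)]

theorem abs_sub_gridPoint_le {ω : ℕ} (hω : 0 < ω) {k j : ℤ} {x : ℝ} (hx : x ∈ gridCell ω k j) :
    |(k - x) - gridPoint ω j| ≤ 1 / ω := by
  have hω' : (0 : ℝ) < ω := by exact_mod_cast hω
  obtain ⟨h1, h2⟩ := hx
  rw [div_lt_iff₀ hω'] at h1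
  rw [le_div_iff₀ hω'] at h2
  push_cast at h1 h2
  have e : (k - x) - gridPoint ω j = ((k - x) * ω - gridPoint ω j * ω) / ω := by
    field_simp
  rw [e, abs_div, Nat.abs_cast]
  gcongr
  unfold gridPoint
  split_ifs <;> rw [div_mul_cancel₀ _ hω'.ne', abs_le] <;> constructor <;> linarith

/-- Each positive integer `n` is taken exactly twice, at `j = n` and `j = 1 - n`, so this is twice a
convergent `p`-series. -/
theorem summable_gridDist_rpow {p : ℝ} (hp : p < -1) : Summable fun j : ℤ => gridDist j ^ p := by
  have h := Real.summable_nat_rpow.2 hp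
  refine Summable.of_nat_of_neg_add_one ?_ ?_
  · refine (summable_nat_add_iff 1).1 (((summable_nat_add_iff 1).2 h).congr fun n => ?_)
    have : gridDist ((n + 1 : ℕ) : ℤ) = ((n + 1 : ℕ) : ℝ) := by
      rw [gridDist, if_neg (by omega)]; simp
    rw [this]
  · refine ((summable_nat_add_iff 2).2 h).congr fun n => ?_
    have : gridDist (-((n : ℤ) + 1)) = ((n + 2 : ℕ) : ℝ) := by
      rw [gridDist, if_pos (by omega)]; push_cast; ring
    rw [this]

/-! ### Discretization error. -/

theorem enorm_rpow_eq_ofReal {α : ℝ} (hα : 0 ≤ α) (y : ℝ) :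
    ‖y‖ₑ ^ α = ENNReal.ofReal (|y| ^ α) := by
  rw [← ENNReal.ofReal_rpow_of_nonneg (abs_nonneg y) hα, Real.enorm_eq_ofReal_abs]

/-- The `α`-th power of the `L ^ α`-error of the step approximation of `x ↦ g (k - x)`. -/
theorem powLIntegral_sub_stepApprox_le {α : ℝ} (hα : 0 < α) {g : ℝ → ℝ} {γ a c η : ℝ}
    (hc : 0 < c) (ha : 0 < a)
    (hinc : ∀ u h : ℝ, u ≠ 0 → |h| < η → |g (u + h) - g u| ≤ c * |h| ^ a * |u| ^ (γ - a))
    {ω : ℕ} (hω : 0 < ω) (hωη : 1 / (ω : ℝ) < η) (hγa : α * (γ - a) < -1) (Ω : ℕ) (k : ℤ) :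
    powLIntegral α volume (fun x => g (k - x) - stepApprox g ω Ω k x) ≤
      ENNReal.ofReal (c ^ α * (∑' j : ℤ, gridDist j ^ (α * (γ - a))) * (ω : ℝ) ^ (-1 - α * γ)) +
        ∫⁻ u in {u : ℝ | (Ω : ℝ) ≤ |u|}, ‖g u‖ₑ ^ α := by
  have hω' : (0 : ℝ) < ω := by exact_mod_cast hω
  set U : Set ℝ := ⋃ j ∈ gridIndex ω Ω, gridCell ω k j with hU
  have hUm : MeasurableSet U := Finset.measurableSet_biUnion _ fun _ _ => measurableSet_Ioc
  rw [powLIntegral, ← lintegral_add_compl _ hUm]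
  refine add_le_add ?_ ?_
  · rw [hU, lintegral_biUnion_finset (fun i _ j _ hij => pairwise_disjoint_gridCell hω k hij)
      (fun _ _ => measurableSet_Ioc)]
    have hcell : ∀ j ∈ gridIndex ω Ω,
        ∫⁻ x in gridCell ω k j, ‖g (k - x) - stepApprox g ω Ω k x‖ₑ ^ α ≤
          ENNReal.ofReal (c ^ α * (ω : ℝ) ^ (-1 - α * γ) * gridDist j ^ (α * (γ - a))) := by
      intro j hj
      have hd := one_le_gridDist j
      have hpt : ∀ x ∈ gridCell ω k j, ‖g (k - x) - stepApprox g ω Ω k x‖ₑ ^ α ≤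
          ENNReal.ofReal ((c * (1 / ω) ^ a * (gridDist j / ω) ^ (γ - a)) ^ α) := by
        intro x hx
        rw [stepApprox_of_mem g hω hj hx, enorm_rpow_eq_ofReal hα.le]
        refine ENNReal.ofReal_le_ofReal (Real.rpow_le_rpow (abs_nonneg _) ?_ hα.le)
        have hle := abs_sub_gridPoint_le hω hx
        have h0 : gridPoint ω j ≠ 0 := by
          rw [← abs_pos, abs_gridPoint]
          positivity
        -- The increment is based at the grid point, not at `k - x`: the far endpoint is never 0, so
        -- the bound is finite and uniform on the cell, even next to the origin.
        have h := hinc (gridPoint ω j) (k - x - gridPoint ω j) h0 (hle.trans_lt hωη)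
        rw [add_sub_cancel, abs_gridPoint] at h
        refine h.trans ?_
        gcongr
      refine (setLIntegral_mono measurable_const hpt).trans ?_
      rw [setLIntegral_const, gridCell, Real.volume_Ioc, ← ENNReal.ofReal_mul (by positivity)]
      refine ENNReal.ofReal_le_ofReal (le_of_eq ?_)
      have hd0 : 0 < gridDist j := by linarith
      rw [← sub_div, add_sub_cancel_left, Real.mul_rpow (by positivity) (by positivity),
        Real.mul_rpow hc.le (by positivity), ← Real.rpow_mul (by positivity),
        ← Real.rpow_mul (by positivity), Real.div_rpow hd0.le hω'.le, one_div,
        Real.inv_rpow hω'.le, mul_comm (γ - a) α]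
      have : (ω : ℝ) ^ (-1 - α * γ) = ((ω : ℝ) ^ (a * α))⁻¹ * ((ω : ℝ) ^ (α * (γ - a)))⁻¹ *
          (ω : ℝ)⁻¹ := by
        rw [← Real.rpow_neg hω'.le, ← Real.rpow_neg hω'.le, ← Real.rpow_neg_one,
          ← Real.rpow_add hω', ← Real.rpow_add hω']
        congr 1
        ring
      rw [this]
      field_simp
    refine (Finset.sum_le_sum hcell).trans ?_
    rw [← ENNReal.ofReal_sum_of_nonneg]
    · refine ENNReal.ofReal_le_ofReal ?_
      rw [← Finset.mul_sum, mul_right_comm]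
      gcongr
      exact (summable_gridDist_rpow hγa).sum_le_tsum _
        fun j _ => Real.rpow_nonneg (by linarith [one_le_gridDist j]) _
    · intro j _
      have := one_le_gridDist j
      positivity
  · have hT : MeasurableSet {u : ℝ | (Ω : ℝ) ≤ |u|} :=
      measurableSet_le measurable_const measurable_id.abs
    have hpt : ∀ x, Uᶜ.indicator (fun x => ‖g (k - x) - stepApprox g ω Ω k x‖ₑ ^ α) x ≤
        {u : ℝ | (Ω : ℝ) ≤ |u|}.indicator (fun u => ‖g u‖ₑ ^ α) (k - x) := by
      intro x
      by_cases hx : x ∈ U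
      · simp [hx]
      · have hx' : ∀ j ∈ gridIndex ω Ω, x ∉ gridCell ω k j := by simpa [hU] using hx
        -- The cells cover all `x` with `|k - x| < Ω`, so an uncovered point lies in the tail.
        have hmem : (k : ℝ) - x ∈ {u : ℝ | (Ω : ℝ) ≤ |u|} := by
          by_contra hcon
          obtain ⟨j, hj, hxj⟩ := exists_mem_gridCell hω Ω k (not_le.1 hcon)
          exact hx' j hj hxj
        rw [Set.indicator_of_mem hx, Set.indicator_of_mem hmem, stepApprox_of_notMem g hx',
          sub_zero]
    rw [← lintegral_indicator hUm.compl, ← lintegral_indicator hT,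
      ← lintegral_sub_left_eq_self ({u : ℝ | (Ω : ℝ) ≤ |u|}.indicator _) (k : ℝ)]
    exact lintegral_mono hpt

/-! ### Truncation error. -/

theorem tendsto_setLIntegral_abs_ge {f : ℝ → ENNReal} (hf : AEMeasurable f)
    (hfin : ∫⁻ u, f u ≠ ⊤) :
    Tendsto (fun n : ℕ => ∫⁻ u in {u : ℝ | (n : ℝ) ≤ |u|}, f u) atTop (𝓝 0) := by
  have hT : ∀ n : ℕ, MeasurableSet {u : ℝ | (n : ℝ) ≤ |u|} := fun n =>
    measurableSet_le measurable_const measurable_id.abs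
  simp only [← lintegral_indicator (hT _)]
  rw [← lintegral_zero (μ := (volume : Measure ℝ))]
  refine tendsto_lintegral_of_dominated_convergence' f (fun n => hf.indicator (hT n))
    (fun n => Eventually.of_forall fun u => Set.indicator_le_self _ _ _) hfin
    (Eventually.of_forall fun u => ?_)
  refine tendsto_const_nhds.congr' ?_
  obtain ⟨N, hN⟩ := exists_nat_gt |u|
  filter_upwards [eventually_ge_atTop N] with n hn
  have : (N : ℝ) ≤ n := by exact_mod_cast hn
  exact (Set.indicator_of_notMem (by
    intro h
    have h : (n : ℝ) ≤ |u| := h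
    linarith) _).symm

theorem setLIntegral_abs_ge_rpow {p R : ℝ} (hp : p < -1) (hR : 0 < R) :
    ∫⁻ u in {u : ℝ | R ≤ |u|}, ENNReal.ofReal (|u| ^ p) ≤
      ENNReal.ofReal (2 * (-R ^ (p + 1) / (p + 1))) := by
  have hset : {u : ℝ | R ≤ |u|} = Set.Ici R ∪ Set.Iic (-R) := by
    ext u
    simp only [Set.mem_ofPred_eq, Set.mem_union, Set.mem_Ici, Set.mem_Iic, le_abs, le_neg]
  have hneg : ∫⁻ u in Set.Iic (-R), ENNReal.ofReal (|u| ^ p) =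
      ∫⁻ u in Set.Ici R, ENNReal.ofReal (|u| ^ p) := by
    rw [← lintegral_indicator measurableSet_Iic, ← lintegral_indicator measurableSet_Ici,
      ← lintegral_neg_eq_self]
    refine lintegral_congr fun u => ?_
    simp only [Set.indicator, Set.mem_Iic, Set.mem_Ici, neg_le_neg_iff, abs_neg]
  have hpos : ∫⁻ u in Set.Ici R, ENNReal.ofReal (|u| ^ p) =
      ENNReal.ofReal (-R ^ (p + 1) / (p + 1)) := by
    rw [setLIntegral_congr Ioi_ae_eq_Ici.symm, ← integral_Ioi_rpow_of_lt hp hR,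
      ofReal_integral_eq_lintegral_ofReal (integrableOn_Ioi_rpow_of_lt hp hR)]
    · refine setLIntegral_congr_fun measurableSet_Ioi fun u hu => ?_
      simp only [abs_of_pos (hR.trans hu)]
    · filter_upwards [ae_restrict_mem measurableSet_Ioi] with u hu
      exact Real.rpow_nonneg (hR.trans hu).le _
  rw [hset]
  refine (lintegral_union_le _ _ _).trans (le_of_eq ?_)
  have hnn : 0 ≤ -R ^ (p + 1) / (p + 1) :=
    div_nonneg_of_nonpos (neg_nonpos.2 (by positivity)) (by linarith)
  rw [hneg, hpos, two_mul, ENNReal.ofReal_add hnn hnn]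

theorem exists_setLIntegral_abs_ge_le {α : ℝ} (hα : 0 < α) {g : ℝ → ℝ}
    (hfin : ∫⁻ u, ‖g u‖ₑ ^ α ≠ ⊤) {C β : ℝ} (hC : 0 < C) (hβ : 1 < α * β)
    (hdec : ∀ᶠ x : ℝ in cocompact ℝ, |g x| ≤ C * |x| ^ (-β)) :
    ∃ K : ℝ, 0 ≤ K ∧ ∀ Ω : ℕ, 1 ≤ Ω →
      ∫⁻ u in {u : ℝ | (Ω : ℝ) ≤ |u|}, ‖g u‖ₑ ^ α ≤
        ENNReal.ofReal (K * (Ω : ℝ) ^ (1 - α * β)) := by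
  obtain ⟨R, hR⟩ : ∃ R : ℝ, ∀ x, R ≤ |x| → |g x| ≤ C * |x| ^ (-β) := by
    obtain ⟨R, hR⟩ := (Metric.hasBasis_cobounded_compl_ball (0 : ℝ)).eventually_iff.1
      (Metric.cobounded_eq_cocompact (α := ℝ) ▸ hdec) |>.imp fun R h => h.2
    exact ⟨R, fun x hx => hR (by simpa using hx)⟩
  set V := (∫⁻ u, ‖g u‖ₑ ^ α).toReal with hV
  set R' := max R 1 with hR'
  have hR'1 : 1 ≤ R' := le_max_right _ _
  have hβ' : 0 < α * β - 1 := by linarith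
  -- The first term is the integral of the decay bound over both half-lines, valid once `Ω ≥ R'`.
  -- For `Ω < R'` the second dominates the total mass `V`, since `(R' / Ω) ^ (α * β - 1) ≥ 1`.
  refine ⟨C ^ α * (2 / (α * β - 1)) + V * R' ^ (α * β - 1), by positivity, fun Ω hΩ => ?_⟩
  have hΩ' : (1 : ℝ) ≤ Ω := by exact_mod_cast hΩ
  have hΩ0 : (0 : ℝ) < Ω := by linarith
  have hT : MeasurableSet {u : ℝ | (Ω : ℝ) ≤ |u|} :=
    measurableSet_le measurable_const measurable_id.abs
  rw [add_mul]
  rcases le_or_gt R' Ω with h | h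
  · have hpt : ∀ u ∈ {u : ℝ | (Ω : ℝ) ≤ |u|}, ‖g u‖ₑ ^ α ≤
        ENNReal.ofReal (C ^ α) * ENNReal.ofReal (|u| ^ (-(α * β))) := by
      intro u hu
      have hu : (Ω : ℝ) ≤ |u| := hu
      have h1 := hR u ((le_max_left R 1).trans (h.trans hu))
      rw [enorm_rpow_eq_ofReal hα.le, ← ENNReal.ofReal_mul (by positivity)]
      refine ENNReal.ofReal_le_ofReal ((Real.rpow_le_rpow (abs_nonneg _) h1 hα.le).trans
        (le_of_eq ?_))
      rw [Real.mul_rpow hC.le (by positivity), ← Real.rpow_mul (abs_nonneg _)]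
      congr 2
      ring
    refine (setLIntegral_mono (by fun_prop) hpt).trans ?_
    rw [lintegral_const_mul' _ _ ENNReal.ofReal_ne_top]
    refine (mul_le_mul_right (setLIntegral_abs_ge_rpow (by linarith) hΩ0) _).trans ?_
    rw [← ENNReal.ofReal_mul (by positivity)]
    refine ENNReal.ofReal_le_ofReal ?_
    have e : C ^ α * (2 * (-(Ω : ℝ) ^ (-(α * β) + 1) / (-(α * β) + 1))) =
        C ^ α * (2 / (α * β - 1)) * (Ω : ℝ) ^ (1 - α * β) := by
      rw [show -(α * β) + 1 = 1 - α * β by ring, show 1 - α * β = -(α * β - 1) by ring, neg_div_neg_eq]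
      ring
    rw [e]
    exact le_add_of_nonneg_right (by positivity)
  · refine (setLIntegral_le_lintegral _ _).trans ?_
    rw [← ENNReal.ofReal_toReal hfin]
    refine ENNReal.ofReal_le_ofReal ?_
    have h1 : 1 ≤ R' ^ (α * β - 1) * (Ω : ℝ) ^ (1 - α * β) := by
      rw [show 1 - α * β = -(α * β - 1) by ring, Real.rpow_neg hΩ0.le, ← div_eq_mul_inv,
        one_le_div (by positivity)]
      gcongr
    have h2 : V ≤ V * (R' ^ (α * β - 1) * (Ω : ℝ) ^ (1 - α * β)) :=
      le_mul_of_one_le_right ENNReal.toReal_nonneg h1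
    rw [← hV, mul_assoc V]
    exact h2.trans (le_add_of_nonneg_left (by positivity))

/-! ### Conclusion. -/

theorem corollary5p2 {S : Type*} [MeasurableSpace S] (P : Measure S) [IsProbabilityMeasure P]
    (α : ℝ) (hα0 : 0 < α) (hα2 : α ≤ 2)
    (M : Set ℝ → S → ℝ) (hM : IsSymmetricStableRandomMeasure P α volume M)
    (g : ℝ → ℝ) (hg : MemLp g (ENNReal.ofReal α) volume)
    (c₀p c₀m γ a c η : ℝ) (hc : 0 < c) (hη : 0 < η)
    (hγ : 0 < γ + 1 / α) (hγa : γ + 1 / α < a) (ha : a ≤ 1)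
    (hgp : Tendsto (fun r : ℝ => g r / r ^ γ) (𝓝[>] 0) (𝓝 c₀p))
    (hgm : Tendsto (fun r : ℝ => g (-r) / r ^ γ) (𝓝[>] 0) (𝓝 c₀m))
    (hinc : ∀ u h : ℝ, u ≠ 0 → |h| < η → |g (u + h) - g u| ≤ c * |h| ^ a * |u| ^ (γ - a))
    (Y : ℝ → S → ℝ) (hY : IsMovingAverage P α M g Y) :
    -- the error is symmetric stable, so that its `α`-norm (scale factor) is meaningful
    (∀ (ω Ω : ℕ) (k : ℤ), HasSymmetricStableLaw P α
      (stableNorm P α (approxError M g Y ω Ω k)) (approxError M g Y ω Ω k)) ∧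
    (∀ k : ℤ, Tendsto (fun p : ℕ × ℕ => stableNorm P α (approxError M g Y p.1 p.2 k))
      (atTop ×ˢ atTop) (𝓝 0)) ∧
    (∀ C β : ℝ, 0 < C → 1 / α < β →
      (∀ᶠ x : ℝ in cocompact ℝ, |g x| ≤ C * |x| ^ (-β)) →
      ∃ K : ℝ, 0 < K ∧ ∀ (ω Ω : ℕ) (k : ℤ), 1 / η < (ω : ℝ) → 1 ≤ Ω →
        stableNorm P α (approxError M g Y ω Ω k) ^ α ≤
          K * ((ω : ℝ) ^ (-1 - α * γ) + (Ω : ℝ) ^ (1 - α * β))) := by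
  have hα' : α * (1 / α) = 1 := mul_one_div_cancel hα0.ne'
  have ha0 : 0 < a := hγ.trans hγa
  have hexp : α * (γ - a) < -1 := by nlinarith
  have hγ' : 0 < 1 + α * γ := by nlinarith
  have hfin : ∫⁻ u, ‖g u‖ₑ ^ α ≠ ⊤ := (hg.powLIntegral_lt_top hα0).ne
  have hlaw := fun ω Ω k => hY.hasSymmetricStableLaw_approxError hM hα0 hg ω Ω k
  have hnorm := fun ω Ω k => (hlaw ω Ω k).stableNorm_eq hα0
  have hpow : ∀ ω Ω k, stableNorm P α (approxError M g Y ω Ω k) ^ α =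
      (powLIntegral α volume fun x => g (k - x) - stepApprox g ω Ω k x).toReal := by
    intro ω Ω k
    rw [hnorm, ← Real.rpow_mul ENNReal.toReal_nonneg, one_div_mul_cancel hα0.ne', Real.rpow_one]
  set T : ℝ := c ^ α * ∑' j : ℤ, gridDist j ^ (α * (γ - a)) with hT
  have hT0 : 0 ≤ T := mul_nonneg (by positivity) (tsum_nonneg fun j =>
    Real.rpow_nonneg (by linarith [one_le_gridDist j]) _)
  have hbound : ∀ (ω Ω : ℕ) (k : ℤ), 1 / η < (ω : ℝ) →
      powLIntegral α volume (fun x => g (k - x) - stepApprox g ω Ω k x) ≤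
        ENNReal.ofReal (T * (ω : ℝ) ^ (-1 - α * γ)) +
          ∫⁻ u in {u : ℝ | (Ω : ℝ) ≤ |u|}, ‖g u‖ₑ ^ α := by
    intro ω Ω k hω
    have hω0 : (0 : ℝ) < ω := (one_div_pos.2 hη).trans hω
    exact powLIntegral_sub_stepApprox_le hα0 hc ha0 hinc (by exact_mod_cast hω0)
      ((one_div_lt hη hω0).1 hω) hexp Ω k
  refine ⟨fun ω Ω k => hnorm ω Ω k ▸ hlaw ω Ω k, fun k => ?_, fun C β hC hβ hdec => ?_⟩
  · have hdisc : Tendsto (fun ω : ℕ => ENNReal.ofReal (T * (ω : ℝ) ^ (-1 - α * γ))) atTop (𝓝 0) := by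
      have h := ((tendsto_rpow_neg_atTop hγ').comp tendsto_natCast_atTop_atTop).const_mul T
      rw [mul_zero] at h
      rw [show -1 - α * γ = -(1 + α * γ) by ring, ← ENNReal.ofReal_zero]
      exact ENNReal.tendsto_ofReal h
    have htail := tendsto_setLIntegral_abs_ge (hg.1.enorm.pow_const α) hfin
    have hsum := (hdisc.comp tendsto_fst).add (htail.comp (tendsto_snd (f := atTop (α := ℕ))))
    rw [add_zero] at hsum
    have hV : Tendsto (fun p : ℕ × ℕ =>
        powLIntegral α volume fun x => g (k - x) - stepApprox g p.1 p.2 k x)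
        (atTop ×ˢ atTop) (𝓝 0) := by
      refine tendsto_of_tendsto_of_tendsto_of_le_of_le' tendsto_const_nhds hsum
        (Eventually.of_forall fun _ => zero_le) ?_
      have h1 : ∀ᶠ ω : ℕ in atTop, 1 / η < (ω : ℝ) :=
        tendsto_natCast_atTop_atTop.eventually_gt_atTop _
      filter_upwards [tendsto_fst.eventually h1] with p hp
      exact hbound p.1 p.2 k hp
    have hV' := ((ENNReal.tendsto_toReal ENNReal.zero_ne_top).comp hV).rpow_const
      (p := 1 / α) (Or.inr (one_div_pos.2 hα0).le)
    rw [ENNReal.toReal_zero, Real.zero_rpow (one_div_pos.2 hα0).ne'] at hV'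
    simp only [hnorm]
    exact hV'
  · have hβ' : 1 < α * β := by nlinarith
    obtain ⟨K, hK0, hK⟩ := exists_setLIntegral_abs_ge_le hα0 hfin hC hβ' hdec
    -- `T` and `K` are only known to be nonnegative; the 1 makes the constant positive.
    refine ⟨T + K + 1, by positivity, fun ω Ω k hω hΩ => ?_⟩
    have h1 : 0 ≤ (ω : ℝ) ^ (-1 - α * γ) := by positivity
    have h2 : 0 ≤ (Ω : ℝ) ^ (1 - α * β) := by positivity
    rw [hpow]
    refine ENNReal.toReal_le_of_le_ofReal (by positivity) ((hbound ω Ω k hω).trans ?_)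
    refine (add_le_add_right (hK Ω hΩ) _).trans ?_
    rw [← ENNReal.ofReal_add (by positivity) (by positivity)]
    refine ENNReal.ofReal_le_ofReal ?_
    nlinarith [mul_nonneg hT0 h2, mul_nonneg hK0 h1]
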